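/- An $n$-permutation $p=(p_1,p_2,\dots,p_n)$ is said to contain a $k$-permutation (pattern) $q=(q_1,q_2,\dots,q_k)$ if there are positions $1\le a_1<a_2<\cdots<a_k\le n$ such that, for all $1\le s,t\le k$, $p_{a_s}<p_{a_t}$ if and only if $q_s<q_t$; otherwise $p$ avoids $q$. Let $S_n(q)$ denote the number of $n$-permutations that avoid $q$. Then for all $n\ge 6$, $$S_n(1342)<S_n(1234).$$ -/

import Mathlib

namespace PatternAvoidance

/-- The `n`-permutation `p` contains the `k`-permutation `q`: some entries of `p`, at positions
`f 0 < f 1 < … < f (k - 1)`, are in the same relative order as the entries of `q`. Permutations are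
in one-line notation, with positions and entries numbered from `0` instead of `1`. -/
def Contains {n k : ℕ} (p : Equiv.Perm (Fin n)) (q : Equiv.Perm (Fin k)) : Prop :=
  ∃ f : Fin k → Fin n, StrictMono f ∧ ∀ a b : Fin k, p (f a) < p (f b) ↔ q a < q b

/-- The `n`-permutation `p` avoids the pattern `q`. -/
def Avoids {n k : ℕ} (p : Equiv.Perm (Fin n)) (q : Equiv.Perm (Fin k)) : Prop :=
  ¬ Contains p q

/-- `S n q` is the number of `n`-permutations that avoid the pattern `q`. -/
noncomputable def S (n : ℕ) {k : ℕ} (q : Equiv.Perm (Fin k)) : ℕ :=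
  Nat.card {p : Equiv.Perm (Fin n) // Avoids p q}

/-- The pattern `1342`. -/
def pattern1342 : Equiv.Perm (Fin 4) where
  toFun := ![0, 2, 3, 1]
  invFun := ![0, 3, 1, 2]
  left_inv := by decide
  right_inv := by decide

/-- The pattern `1234`. -/
def pattern1234 : Equiv.Perm (Fin 4) where
  toFun := ![0, 1, 2, 3]
  invFun := ![0, 1, 2, 3]
  left_inv := by decide
  right_inv := by decide

end PatternAvoidance

/-!
The reverse complement turns `1342` into `3124 = 312 ⊕ 1`, while `1234 = 123 ⊕ 1`. For `R` one of
`312` and `123`, a permutation is built by inserting its entries in increasing order. Inserting a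
new maximum at position `t` creates no copy of `R ⊕ 1` exactly when the first `t` entries avoid
`R`. To turn this into a recurrence, one counts (`count R n j X`) the `n`-permutations that avoid
`R ⊕ 1`, whose first `j` entries avoid `R`, and which have a descent into each position in a set
`X ⊆ {1, …, j - 1}`. Let the maximum be inserted at `t < j`. For `R = 312` it must not lie in `X`,
and the entries after it, within the first `j`, must decrease; so `X` is replaced by
`{h ∈ X | h < t} ∪ {t + 1, …, j - 2}`. For `R = 123` the entries before it must decrease, and the
family of counts with `X = {1, …, x}` is closed under the recurrence. These recurrences are
`count_312` and `count_123`.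

The inequality is the case `X = ∅`, `j = 0` of the following one (`num312_le_num123`): the count for
`312` with the set `X` is at most the count for `123` with `{1, …, #X}`. It follows by induction on
`n`, because the sizes of the new sets match up: as `t` runs through the positions below `j - 1`
outside `X`, the size of the new set takes consecutive values up to `j - 2`, once each
(`sum_notMem_eq_sum_Ico`). What remains is the term `t = j - 1`, where the `123` side is at least as
large since its counts decrease in `x` (`num123_antitone`). The inequality is strict for `n = 6`, by
evaluation, and strictness passes from `n` to `n + 1` through the permutations in which the maximum
comes first.
-/

namespace PatternAvoidance

open Equiv Finset

/-- The entries `u, v, w`, in this order, form the pattern `312`. -/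
def Is312 (u v w : ℕ) : Prop := v < w ∧ w < u

/-- The entries `u, v, w`, in this order, form the pattern `123`. -/
def Is123 (u v w : ℕ) : Prop := u < v ∧ v < w

/-- No three entries of `σ` that satisfy `R` are followed by an entry larger than all three. For
`R = Is312` and `R = Is123` this says that `σ` avoids `3124` and `1234` respectively. -/
def AvoidsBelowLater (R : ℕ → ℕ → ℕ → Prop) {n : ℕ} (σ : Perm (Fin n)) : Prop :=
  ∀ a b c d : Fin n, a < b → b < c → c < d → R (σ a) (σ b) (σ c) →
    ¬ (σ a < σ d ∧ σ b < σ d ∧ σ c < σ d)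

/-- No three of the first `j` entries of `σ` satisfy `R`. -/
def PrefixAvoids (R : ℕ → ℕ → ℕ → Prop) {n : ℕ} (σ : Perm (Fin n)) (j : ℕ) : Prop :=
  ∀ a b c : Fin n, a < b → b < c → (c : ℕ) < j → ¬ R (σ a) (σ b) (σ c)

/-- For each position `h ∈ X` (counted from `0`), the entry at `h` is smaller than the one before
it. -/
def DescendsInto {n : ℕ} (σ : Perm (Fin n)) (X : Finset ℕ) : Prop :=
  ∀ a b : Fin n, (a : ℕ) + 1 = b → (b : ℕ) ∈ X → σ b < σ a

/-- The number of `n`-permutations that avoid `R` followed by a larger entry, avoid `R` in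
their first `j` entries, and descend into each position in `X`. -/
noncomputable def count (R : ℕ → ℕ → ℕ → Prop) (n j : ℕ) (X : Finset ℕ) : ℕ :=
  Nat.card {σ : Perm (Fin n) // AvoidsBelowLater R σ ∧ PrefixAvoids R σ j ∧ DescendsInto σ X}

/-! ### Insertion of a new maximum -/

/-- Insert a new largest entry into `σ` at position `t`. -/
def insertMax {n : ℕ} (t : Fin (n + 1)) (σ : Perm (Fin n)) : Perm (Fin (n + 1)) :=
  (finSuccEquiv' t).trans ((Equiv.optionCongr σ).trans finSuccEquivLast.symm)

section Insert

variable {n : ℕ} (t : Fin (n + 1)) (σ : Perm (Fin n))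

@[simp] lemma insertMax_self : insertMax t σ t = Fin.last n := by
  simp [insertMax]

@[simp] lemma insertMax_succAbove (i : Fin n) :
    insertMax t σ (t.succAbove i) = (σ i).castSucc := by
  simp [insertMax]

lemma insertMax_bijective :
    Function.Bijective fun x : Fin (n + 1) × Perm (Fin n) => insertMax x.1 x.2 := by
  rw [Fintype.bijective_iff_injective_and_card]
  refine ⟨?_, by simp [Fintype.card_perm, Nat.factorial_succ]⟩
  rintro ⟨t, σ⟩ ⟨s, τ⟩ h
  have hts : t = s := by
    apply (insertMax t σ).injective
    rw [insertMax_self, show insertMax t σ = insertMax s τ from h, insertMax_self]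
  subst hts
  congr 1
  ext i
  have := congrArg (fun p : Perm (Fin (n + 1)) => (p (t.succAbove i) : ℕ)) h
  simpa using this

/-- Counting permutations of `n + 1` elements by the position of the maximum. -/
lemma card_perm_succ_eq_sum (P : Perm (Fin (n + 1)) → Prop) :
    Nat.card {p // P p} = ∑ t : Fin (n + 1), Nat.card {σ : Perm (Fin n) // P (insertMax t σ)} := by
  classical
  let e := Equiv.ofBijective _ (insertMax_bijective (n := n))
  have h : {p // P p} ≃ Σ t : Fin (n + 1), {σ : Perm (Fin n) // P (insertMax t σ)} :=
    (e.subtypeEquiv (p := fun x => P (insertMax x.1 x.2)) fun _ => Iff.rfl).symm.trans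
      (Equiv.subtypeProdEquivSigmaSubtype fun t σ => P (insertMax t σ))
  rw [Nat.card_congr h, Nat.card_sigma]

lemma val_succAbove (i : Fin n) :
    (t.succAbove i : ℕ) = if (i : ℕ) < t then (i : ℕ) else i + 1 := by
  simp only [Fin.succAbove, Fin.lt_def, Fin.val_castSucc]
  split_ifs <;> simp

variable {t σ}

lemma exists_succAbove_of_insertMax_lt {i k : Fin (n + 1)}
    (h : insertMax t σ i < insertMax t σ k) : ∃ i', t.succAbove i' = i := by
  refine Fin.exists_succAbove_eq ?_
  rintro rfl
  rw [insertMax_self] at h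
  exact absurd h (Fin.le_last _).not_gt

/-- Only the fourth role can be played by the new maximum. -/
lemma avoidsBelowLater_insertMax {R : ℕ → ℕ → ℕ → Prop} :
    AvoidsBelowLater R (insertMax t σ) ↔ AvoidsBelowLater R σ ∧ PrefixAvoids R σ t := by
  constructor
  · refine fun h => ⟨fun a b c d hab hbc hcd hR => ?_, fun a b c hab hbc hc hR => ?_⟩
    · simpa using h (t.succAbove a) (t.succAbove b) (t.succAbove c) (t.succAbove d)
        (by simpa) (by simpa) (by simpa) (by simpa using hR)
    · refine h (t.succAbove a) (t.succAbove b) (t.succAbove c) t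
        (by simpa) (by simpa) ?_ (by simpa using hR) (by simp [Fin.castSucc_lt_last])
      simp [Fin.lt_def, val_succAbove, hc]
  · rintro ⟨h, h'⟩ a b c d hab hbc hcd hR ⟨ha, hb, hc⟩
    obtain ⟨a, rfl⟩ := exists_succAbove_of_insertMax_lt ha
    obtain ⟨b, rfl⟩ := exists_succAbove_of_insertMax_lt hb
    obtain ⟨c, rfl⟩ := exists_succAbove_of_insertMax_lt hc
    simp only [insertMax_succAbove, Fin.val_castSucc, Fin.succAbove_lt_succAbove_iff] at *
    by_cases hd : d = t
    · subst hd
      refine h' a b c hab hbc ?_ hR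
      simp only [Fin.lt_def, val_succAbove] at hcd
      split_ifs at hcd <;> omega
    · obtain ⟨d, rfl⟩ := Fin.exists_succAbove_eq hd
      simp only [insertMax_succAbove, Fin.castSucc_lt_castSucc_iff,
        Fin.succAbove_lt_succAbove_iff] at *
      exact h a b c d hab hbc hcd hR ⟨ha, hb, hc⟩

lemma prefixAvoids_insertMax_of_le {R : ℕ → ℕ → ℕ → Prop} {j : ℕ} (hj : j ≤ t) :
    PrefixAvoids R (insertMax t σ) j ↔ PrefixAvoids R σ j := by
  constructor
  · intro h a b c hab hbc hc hR
    refine h (t.succAbove a) (t.succAbove b) (t.succAbove c)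
      (by simpa) (by simpa) ?_ (by simpa using hR)
    rw [val_succAbove]
    split_ifs <;> omega
  · intro h a b c hab hbc hc hR
    rw [Fin.lt_def] at hab hbc
    obtain ⟨a, rfl⟩ := Fin.exists_succAbove_eq (x := a) (y := t) (by rintro rfl; omega)
    obtain ⟨b, rfl⟩ := Fin.exists_succAbove_eq (x := b) (y := t) (by rintro rfl; omega)
    obtain ⟨c, rfl⟩ := Fin.exists_succAbove_eq (x := c) (y := t) (by rintro rfl; omega)
    simp only [← Fin.lt_def, Fin.succAbove_lt_succAbove_iff, insertMax_succAbove,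
      Fin.val_castSucc] at hab hbc hR
    refine h a b c hab hbc ?_ hR
    rw [val_succAbove] at hc
    split_ifs at hc <;> omega

lemma descendsInto_insertMax_of_lt {X : Finset ℕ} (hX : ∀ h ∈ X, h < t) :
    DescendsInto (insertMax t σ) X ↔ DescendsInto σ X := by
  constructor
  · intro h a b hab hb
    have hbt := hX _ hb
    have := h (t.succAbove a) (t.succAbove b)
      (by simp only [val_succAbove]; split_ifs <;> omega)
      (by rw [val_succAbove, if_pos hbt]; exact hb)
    simpa using this
  · intro h a b hab hb
    have hbt := hX _ hb
    obtain ⟨a, rfl⟩ := Fin.exists_succAbove_eq (x := a) (y := t) (by rintro rfl; omega)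
    obtain ⟨b, rfl⟩ := Fin.exists_succAbove_eq (x := b) (y := t) (by rintro rfl; omega)
    simp only [val_succAbove] at hab hbt hb
    have hbt' : (b : ℕ) < t := by split_ifs at hbt <;> omega
    rw [if_pos hbt'] at hab hb
    simp only [insertMax_succAbove, Fin.castSucc_lt_castSucc_iff]
    refine h a b ?_ hb
    split_ifs at hab <;> omega

/-- Descents into consecutive positions make the entries at those positions decreasing. -/
lemma DescendsInto.apply_lt {s k : ℕ} (h : DescendsInto σ (Ioo s k)) {a b : Fin n}
    (ha : s ≤ a) (hab : a < b) (hb : (b : ℕ) < k) : σ b < σ a := by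
  obtain ⟨b, hbn⟩ := b
  induction b with
  | zero => exact absurd hab (Nat.not_lt_zero _)
  | succ b ih =>
    have hb' : b < n := by omega
    have step : σ ⟨b + 1, hbn⟩ < σ ⟨b, hb'⟩ := by
      refine h ⟨b, hb'⟩ ⟨b + 1, hbn⟩ rfl ?_
      simp only [Fin.lt_def, mem_Ioo] at *
      omega
    rcases Nat.lt_or_ge a b with hlt | hge
    · exact step.trans (ih hb' hlt ((Nat.lt_succ_self b).trans hb))
    · have : a = ⟨b, hb'⟩ := by
        apply Fin.ext
        simp only [Fin.lt_def] at *
        omega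
      rwa [this]

/-- If the new maximum falls among the first `j` entries, it plays the `3` in every new copy of
`312` there, so the entries after it have to decrease. -/
lemma prefixAvoids_312_insertMax {j : ℕ} (htj : (t : ℕ) < j) :
    PrefixAvoids Is312 (insertMax t σ) j ↔
      PrefixAvoids Is312 σ (j - 1) ∧ DescendsInto σ (Ioo (t : ℕ) (j - 1)) := by
  constructor
  · refine fun h => ⟨fun a b c hab hbc hc hR => ?_, fun a b hab hb => ?_⟩
    · refine h (t.succAbove a) (t.succAbove b) (t.succAbove c)
        (by simpa) (by simpa) ?_ (by simpa using hR)
      rw [val_succAbove]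
      split_ifs <;> omega
    · rw [mem_Ioo] at hb
      by_contra hlt
      have hlt' : σ a < σ b := lt_of_le_of_ne (not_lt.1 hlt) fun e => by
        have := congrArg Fin.val (σ.injective e); omega
      refine h t (t.succAbove a) (t.succAbove b) ?_ ?_ ?_ ?_
      · rw [Fin.lt_def, val_succAbove]; split_ifs <;> omega
      · rw [Fin.succAbove_lt_succAbove_iff, Fin.lt_def]; omega
      · rw [val_succAbove]; split_ifs <;> omega
      · simpa [Is312] using hlt'
  · rintro ⟨h, h'⟩ a b c hab hbc hc ⟨h1, h2⟩
    obtain ⟨b, rfl⟩ := exists_succAbove_of_insertMax_lt (h1.trans h2)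
    obtain ⟨c, rfl⟩ := exists_succAbove_of_insertMax_lt h2
    simp only [insertMax_succAbove, Fin.val_castSucc, Fin.succAbove_lt_succAbove_iff] at *
    have hbc' : (b : ℕ) < c := hbc
    by_cases ha : a = t
    · subst ha
      have hab' : (a : ℕ) ≤ b := by
        rw [Fin.lt_def, val_succAbove] at hab
        split_ifs at hab <;> omega
      refine absurd (h'.apply_lt hab' hbc ?_) (lt_asymm h1)
      rw [val_succAbove] at hc
      split_ifs at hc <;> omega
    · obtain ⟨a, rfl⟩ := Fin.exists_succAbove_eq ha
      simp only [insertMax_succAbove, Fin.val_castSucc, Fin.succAbove_lt_succAbove_iff] at *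
      refine h a b c hab hbc ?_ ⟨h1, h2⟩
      have hab' : (a : ℕ) < b := hab
      rw [val_succAbove] at hc
      split_ifs at hc <;> omega

/-- If the new maximum falls among the first `j` entries, it plays the `3` in every new copy of
`123` there, so the entries before it have to decrease. -/
lemma prefixAvoids_123_insertMax {j : ℕ} (htj : (t : ℕ) < j) :
    PrefixAvoids Is123 (insertMax t σ) j ↔
      PrefixAvoids Is123 σ (j - 1) ∧ DescendsInto σ (Ioo 0 (t : ℕ)) := by
  constructor
  · refine fun h => ⟨fun a b c hab hbc hc hR => ?_, fun a b hab hb => ?_⟩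
    · refine h (t.succAbove a) (t.succAbove b) (t.succAbove c)
        (by simpa) (by simpa) ?_ (by simpa using hR)
      rw [val_succAbove]
      split_ifs <;> omega
    · rw [mem_Ioo] at hb
      by_contra hlt
      have hlt' : σ a < σ b := lt_of_le_of_ne (not_lt.1 hlt) fun e => by
        have := congrArg Fin.val (σ.injective e); omega
      refine h (t.succAbove a) (t.succAbove b) t ?_ ?_ htj ?_
      · rw [Fin.succAbove_lt_succAbove_iff, Fin.lt_def]; omega
      · rw [Fin.lt_def, val_succAbove]; split_ifs <;> omega
      · simpa [Is123] using hlt'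
  · rintro ⟨h, h'⟩ a b c hab hbc hc ⟨h1, h2⟩
    obtain ⟨a, rfl⟩ := exists_succAbove_of_insertMax_lt (h1.trans h2)
    obtain ⟨b, rfl⟩ := exists_succAbove_of_insertMax_lt h2
    simp only [insertMax_succAbove, Fin.val_castSucc, Fin.succAbove_lt_succAbove_iff] at *
    have hab' : (a : ℕ) < b := hab
    by_cases hct : c = t
    · subst hct
      refine absurd (h'.apply_lt (Nat.zero_le _) hab ?_) (lt_asymm h1)
      rw [Fin.lt_def, val_succAbove] at hbc
      split_ifs at hbc <;> omega
    · obtain ⟨c, rfl⟩ := Fin.exists_succAbove_eq hct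
      simp only [insertMax_succAbove, Fin.val_castSucc, Fin.succAbove_lt_succAbove_iff] at *
      refine h a b c hab hbc ?_ ⟨h1, h2⟩
      have hbc' : (b : ℕ) < c := hbc
      rw [val_succAbove] at hc
      split_ifs at hc <;> omega

/-- The new maximum at position `t` creates an ascent into `t`, and a descent out of it. -/
lemma descendsInto_insertMax {k : ℕ} {X : Finset ℕ} (hX : X ⊆ Ioo 0 (k + 1))
    (hσ : DescendsInto σ (Ioo (t : ℕ) k)) :
    DescendsInto (insertMax t σ) X ↔
      (t : ℕ) ∉ X ∧ DescendsInto σ (X.filter (· < (t : ℕ))) := by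
  have hX' : ∀ h ∈ X, 0 < h ∧ h < k + 1 := fun h hh => mem_Ioo.1 (hX hh)
  constructor
  · refine fun h => ⟨fun ht => ?_, ?_⟩
    · have h0 := hX' _ ht
      have := h ⟨t - 1, by omega⟩ t (by simp only; omega) ht
      rw [insertMax_self] at this
      exact absurd this (Fin.le_last _).not_gt
    · rw [← descendsInto_insertMax_of_lt (t := t) (by simp)]
      exact fun a b hab hb => h a b hab (mem_filter.1 hb).1
  · rintro ⟨ht, h⟩ a b hab hb
    rcases lt_trichotomy (b : ℕ) t with hbt | hbt | hbt
    · rw [← descendsInto_insertMax_of_lt (t := t) (by simp)] at h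
      exact h a b hab (mem_filter.2 ⟨hb, hbt⟩)
    · exact absurd (hbt ▸ hb) ht
    · have hbk := hX' _ hb
      obtain ⟨b, rfl⟩ := Fin.exists_succAbove_eq (x := b) (y := t) (by rintro rfl; omega)
      by_cases hat : a = t
      · subst hat
        simp [Fin.castSucc_lt_last]
      · obtain ⟨a, rfl⟩ := Fin.exists_succAbove_eq hat
        simp only [insertMax_succAbove, Fin.castSucc_lt_castSucc_iff]
        have hat' : ¬ ((a : ℕ) = t - 1 ∧ (b : ℕ) = t ∧ (a : ℕ) < t) := by
          rintro ⟨h1, h2, h3⟩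
          simp only [val_succAbove] at hab
          split_ifs at hab <;> omega
        simp only [val_succAbove] at hab hbt hbk
        refine hσ a b ?_ (mem_Ioo.2 ?_) <;> (split_ifs at hab hbt hbk <;> omega)

end Insert

/-! ### Recurrences for the numbers of permutations -/

/-- The numbers `count Is312 n j X`, for `j ≤ n` and `X ⊆ {1, …, j - 1}`, computed by
inserting the maximum at position `t`. -/
def num312 : ℕ → ℕ → Finset ℕ → ℕ
  | 0, _, _ => 1
  | n + 1, j, X => ∑ t ∈ range (n + 1),
      if j ≤ t then num312 n t X
      else if t ∈ X then 0
      else num312 n (j - 1) (X.filter (· < t) ∪ Ioo t (j - 1))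

/-- The numbers `count Is123 n j {1, …, x}`, for `j ≤ n` and `x ≤ j - 1`, computed by inserting
the maximum at position `t`. The truncated `x - 1` at `t = 0` is correct for `x = 0` too: there is
no condition on descents then. -/
def num123 : ℕ → ℕ → ℕ → ℕ
  | 0, _, _ => 1
  | n + 1, j, x => ∑ t ∈ range (n + 1),
      if j ≤ t then num123 n t x
      else if t = 0 then num123 n (j - 1) (x - 1)
      else if t ≤ x then 0
      else num123 n (j - 1) (t - 1)

lemma PrefixAvoids.mono {R : ℕ → ℕ → ℕ → Prop} {n j k : ℕ} {σ : Perm (Fin n)}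
    (h : PrefixAvoids R σ k) (hjk : j ≤ k) : PrefixAvoids R σ j :=
  fun a b c hab hbc hc => h a b c hab hbc (hc.trans_le hjk)

lemma descendsInto_union {n : ℕ} {σ : Perm (Fin n)} {X Y : Finset ℕ} :
    DescendsInto σ (X ∪ Y) ↔ DescendsInto σ X ∧ DescendsInto σ Y := by
  simp only [DescendsInto, mem_union]
  grind

lemma count_zero (R : ℕ → ℕ → ℕ → Prop) (j : ℕ) (X : Finset ℕ) : count R 0 j X = 1 := by
  rw [count, Nat.card_eq_one_iff_unique]
  exact ⟨inferInstance, ⟨1, fun a => a.elim0, fun a => a.elim0, fun a => a.elim0⟩⟩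

/-- A maximum inserted at `t ≥ j` affects neither the first `j` entries nor the descents into
positions below `j`, but it forces the first `t` entries to avoid `R`. -/
lemma card_insertMax_of_le {R : ℕ → ℕ → ℕ → Prop} {n j : ℕ} {X : Finset ℕ} {t : Fin (n + 1)}
    (hX : X ⊆ Ioo 0 j) (hj : j ≤ t) :
    Nat.card {σ : Perm (Fin n) // AvoidsBelowLater R (insertMax t σ) ∧
      PrefixAvoids R (insertMax t σ) j ∧ DescendsInto (insertMax t σ) X} = count R n t X := by
  refine Nat.card_congr (Equiv.subtypeEquivRight fun σ => ?_)
  rw [avoidsBelowLater_insertMax, prefixAvoids_insertMax_of_le hj,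
    descendsInto_insertMax_of_lt fun h hh => (mem_Ioo.1 (hX hh)).2.trans_le hj]
  exact ⟨fun h => ⟨h.1.1, h.1.2, h.2.2⟩, fun h => ⟨⟨h.1, h.2.1⟩, h.2.1.mono hj, h.2.2⟩⟩

lemma count_312 {n j : ℕ} {X : Finset ℕ} (hj : j ≤ n) (hX : X ⊆ Ioo 0 j) :
    count Is312 n j X = num312 n j X := by
  induction n generalizing j X with
  | zero => rw [count_zero, num312]
  | succ n ih =>
    rw [count, card_perm_succ_eq_sum, num312, Finset.sum_range]
    refine sum_congr rfl fun t _ => ?_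
    split_ifs with htj htX
    · rw [card_insertMax_of_le hX htj, ih (by omega)]
      exact hX.trans (Ioo_subset_Ioo_right htj)
    · rw [Nat.card_eq_zero]
      refine Or.inl ⟨fun ⟨σ, h⟩ => ?_⟩
      have hσ := ((prefixAvoids_312_insertMax (not_le.1 htj)).1 h.2.1).2
      refine ((descendsInto_insertMax (hX.trans (Ioo_subset_Ioo_right ?_)) hσ).1 h.2.2).1 htX
      omega
    · rw [← ih (by omega)]
      · refine Nat.card_congr (Equiv.subtypeEquivRight fun σ => ?_)
        rw [avoidsBelowLater_insertMax, prefixAvoids_312_insertMax (not_le.1 htj),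
          descendsInto_union]
        have hX' : X ⊆ Ioo 0 (j - 1 + 1) := hX.trans (Ioo_subset_Ioo_right (by omega))
        constructor
        · rintro ⟨⟨h1, -⟩, ⟨h2, h3⟩, h4⟩
          exact ⟨h1, h2, ((descendsInto_insertMax hX' h3).1 h4).2, h3⟩
        · rintro ⟨h1, h2, h4, h3⟩
          exact ⟨⟨h1, h2.mono (by omega)⟩, ⟨h2, h3⟩, (descendsInto_insertMax hX' h3).2 ⟨htX, h4⟩⟩
      · intro h hh
        simp only [mem_union, mem_filter, mem_Ioo] at hh ⊢
        rcases hh with ⟨hh, h2⟩ | hh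
        · have := mem_Ioo.1 (hX hh); omega
        · omega

lemma descendsInto_insertMax_zero {n x : ℕ} {σ : Perm (Fin n)} :
    DescendsInto (insertMax 0 σ) (Ioo 0 (x + 1)) ↔ DescendsInto σ (Ioo 0 (x - 1 + 1)) := by
  constructor
  · intro h a b hab hb
    rw [mem_Ioo] at hb
    have := h (Fin.succAbove 0 a) (Fin.succAbove 0 b) (by simp; omega) (by simp; omega)
    rwa [insertMax_succAbove, insertMax_succAbove, Fin.castSucc_lt_castSucc_iff] at this
  · intro h a b hab hb
    rw [mem_Ioo] at hb
    obtain ⟨b, rfl⟩ := Fin.exists_succAbove_eq (x := b) (y := 0) (by rintro rfl; simp at hb)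
    by_cases ha : a = 0
    · subst ha
      rw [insertMax_self, insertMax_succAbove]
      exact Fin.castSucc_lt_last _
    · obtain ⟨a, rfl⟩ := Fin.exists_succAbove_eq ha
      rw [insertMax_succAbove, insertMax_succAbove, Fin.castSucc_lt_castSucc_iff]
      simp only [Fin.zero_succAbove, Fin.val_succ] at hab hb
      exact h a b (by omega) (mem_Ioo.2 (by omega))

lemma count_123 {n j x : ℕ} (hj : j ≤ n) (hx : x ≤ j - 1) :
    count Is123 n j (Ioo 0 (x + 1)) = num123 n j x := by
  induction n generalizing j x with
  | zero => rw [count_zero, num123]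
  | succ n ih =>
    rw [count, card_perm_succ_eq_sum, num123, Finset.sum_range]
    refine sum_congr rfl fun t _ => ?_
    split_ifs with htj ht0 htx
    · rw [card_insertMax_of_le _ htj, ih (by omega) (by omega)]
      intro h hh
      rw [mem_Ioo] at hh ⊢
      omega
    · rw [← ih (by omega) (by omega)]
      refine Nat.card_congr (Equiv.subtypeEquivRight fun σ => ?_)
      rw [avoidsBelowLater_insertMax, prefixAvoids_123_insertMax (not_le.1 htj)]
      obtain rfl : t = 0 := Fin.ext ht0
      rw [descendsInto_insertMax_zero]
      constructor
      · rintro ⟨⟨h1, -⟩, ⟨h2, -⟩, h3⟩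
        exact ⟨h1, h2, h3⟩
      · rintro ⟨h1, h2, h3⟩
        exact ⟨⟨h1, h2.mono (by simp)⟩, ⟨h2, fun a b hab hb => by simp at hb⟩, h3⟩
    · rw [Nat.card_eq_zero]
      refine Or.inl ⟨fun ⟨σ, h⟩ => ?_⟩
      have := h.2.2 ⟨t - 1, by omega⟩ t (by simp only; omega) (mem_Ioo.2 (by omega))
      rw [insertMax_self] at this
      exact absurd this (Fin.le_last _).not_gt
    · rw [← ih (by omega) (by omega)]
      refine Nat.card_congr (Equiv.subtypeEquivRight fun σ => ?_)
      rw [avoidsBelowLater_insertMax, prefixAvoids_123_insertMax (not_le.1 htj),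
        descendsInto_insertMax_of_lt fun h hh => by rw [mem_Ioo] at hh; omega,
        show (t : ℕ) - 1 + 1 = t by omega]
      constructor
      · rintro ⟨⟨h1, -⟩, ⟨h2, h3⟩, -⟩
        exact ⟨h1, h2, h3⟩
      · rintro ⟨h1, h2, h3⟩
        refine ⟨⟨h1, h2.mono (by omega)⟩, ⟨h2, h3⟩, fun a b hab hb => h3 a b hab ?_⟩
        rw [mem_Ioo] at hb ⊢
        omega

/-! ### Comparison of the recurrences -/

lemma num123_antitone (n j : ℕ) : Antitone (num123 n j) := by
  induction n generalizing j with
  | zero => exact fun _ _ _ => le_rfl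
  | succ n ih =>
    intro x y hxy
    rw [num123, num123]
    refine sum_le_sum fun t _ => ?_
    split_ifs
    · exact ih _ hxy
    · exact ih _ (Nat.sub_le_sub_right hxy 1)
    · exact le_rfl
    · exact Nat.zero_le _
    · omega
    · exact le_rfl

/-- As `t` runs down through the complement of `X` in `{0, …, K - 1}`, the size of
`{h ∈ X | h < t} ∪ {t + 1, …, K - 1}` runs up through `#X, …, K - 1`. -/
lemma sum_notMem_eq_sum_Ico (g : ℕ → ℕ) (K : ℕ) (X : Finset ℕ) (hX : X ⊆ range K) :
    (∑ t ∈ range K, if t ∈ X then 0 else g (#(X.filter (· < t)) + (K - 1 - t))) =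
      ∑ w ∈ Ico #X K, g w := by
  induction K generalizing g X with
  | zero => simp
  | succ K ih =>
    have hY : X.filter (· < K) ⊆ range K := fun h hh => by simpa using (mem_filter.1 hh).2
    have h1 := ih (fun w => g (w + 1)) (X.filter (· < K)) hY
    have h2 : (∑ t ∈ range K, if t ∈ X then 0 else g (#(X.filter (· < t)) + (K + 1 - 1 - t))) =
        ∑ w ∈ Ico (#(X.filter (· < K)) + 1) (K + 1), g w := by
      rw [← Finset.sum_Ico_add' , ← h1]
      refine sum_congr rfl fun t ht => ?_
      rw [mem_range] at ht
      have h3 : (X.filter (· < K)).filter (· < t) = X.filter (· < t) := by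
        ext h
        simp only [mem_filter]
        grind
      have h4 : t ∈ X.filter (· < K) ↔ t ∈ X := by simp [ht]
      simp only [h3, h4]
      congr 2
      omega
    have hcard : #(X.filter (· < K)) ≤ K := by simpa using card_le_card hY
    have hle : ∀ h ∈ X, h ≤ K := fun h hh => Nat.lt_succ_iff.1 (mem_range.1 (hX hh))
    rw [sum_range_succ, h2]
    split_ifs with hK
    · have : X = insert K (X.filter (· < K)) := by
        ext h
        simp only [mem_insert, mem_filter]
        grind
      have hc : #X = #(X.filter (· < K)) + 1 := by
        conv_lhs => rw [this]
        exact card_insert_of_notMem (by simp)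
      rw [hc, add_zero]
    · have : X.filter (· < K) = X := by
        ext h
        simp only [mem_filter]
        grind
      rw [this] at hcard ⊢
      rw [sum_eq_sum_Ico_succ_bot (a := #X) (by omega)]
      simp [add_comm]

/-- The terms of the two recurrences in which the maximum is inserted among the first `K + 1`
entries, with the values for `n` replaced by an arbitrary antitone function `g`. -/
lemma sum_num312_terms_le (g : ℕ → ℕ) (hg : Antitone g) (K : ℕ) (X : Finset ℕ)
    (hX : X ⊆ Ioo 0 (K + 1)) :
    (∑ t ∈ range (K + 1), if t ∈ X then 0 else g #(X.filter (· < t) ∪ Ioo t K)) ≤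
      ∑ t ∈ range (K + 1), if t = 0 then g (#X - 1) else if t ≤ #X then 0 else g (t - 1) := by
  have hXK : ∀ h ∈ X, 0 < h ∧ h ≤ K := fun h hh => by have := mem_Ioo.1 (hX hh); omega
  have hcard : #X ≤ K := by simpa using card_le_card hX
  have hR : (∑ t ∈ range (K + 1),
      if t = 0 then g (#X - 1) else if t ≤ #X then 0 else g (t - 1)) =
      ∑ w ∈ Ico #X K, g w + g (#X - 1) := by
    rw [sum_range_succ']
    simp only [Nat.add_eq_zero_iff, one_ne_zero, and_false, if_false, if_true,
      Nat.add_sub_cancel]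
    congr 1
    have : Ico #X K = (range K).filter fun t => ¬ t + 1 ≤ #X := by
      ext w
      simp only [mem_Ico, mem_filter, mem_range]
      omega
    rw [this, sum_filter]
    exact sum_congr rfl fun t _ => by split_ifs <;> rfl
  have hY : X.filter (· < K) ⊆ range K := fun h hh => by simpa using (mem_filter.1 hh).2
  have hL : (∑ t ∈ range K, if t ∈ X then 0 else g #(X.filter (· < t) ∪ Ioo t K)) =
      ∑ w ∈ Ico #(X.filter (· < K)) K, g w := by
    rw [← sum_notMem_eq_sum_Ico g K _ hY]
    refine sum_congr rfl fun t ht => ?_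
    rw [mem_range] at ht
    have h1 : (X.filter (· < K)).filter (· < t) = X.filter (· < t) := by
      ext h
      simp only [mem_filter]
      grind
    have h2 : t ∈ X.filter (· < K) ↔ t ∈ X := by simp [ht]
    have h3 : Disjoint (X.filter (· < t)) (Ioo t K) := by
      rw [Finset.disjoint_left]
      intro h hh hh'
      simp only [mem_filter, mem_Ioo] at hh hh'
      omega
    simp only [h1, h2]
    rw [card_union_of_disjoint h3, Nat.card_Ioo, Nat.sub_right_comm]
  rw [hR, sum_range_succ, hL]
  simp only [Ioo_self, union_empty]
  split_ifs with hK
  · -- The bottom term of the left-hand sum is `g (#X - 1)`, and equality holds.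
    have : X = insert K (X.filter (· < K)) := by
      ext h
      simp only [mem_insert, mem_filter]
      grind
    have hc : #X = #(X.filter (· < K)) + 1 := by
      conv_lhs => rw [this]
      exact card_insert_of_notMem (by simp)
    rw [sum_eq_sum_Ico_succ_bot (by omega), hc, add_zero, Nat.add_sub_cancel, add_comm]
  · have : X.filter (· < K) = X := by
      ext h
      simp only [mem_filter]
      grind
    rw [this]
    exact Nat.add_le_add_left (hg (Nat.sub_le _ _)) _

/-- In terms of `count`: the `312`-type permutations that descend into every position of `X` are at
most as many as the `123`-type permutations that descend into the first `#X` possible positions. -/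
lemma num312_le_num123 {n j : ℕ} {X : Finset ℕ} (hj : j ≤ n) (hX : X ⊆ Ioo 0 j) :
    num312 n j X ≤ num123 n j #X := by
  induction n generalizing j X with
  | zero => exact le_rfl
  | succ n ih =>
    rw [num312, num123, ← sum_range_add_sum_Ico _ hj, ← sum_range_add_sum_Ico _ hj]
    refine add_le_add ?_ (sum_le_sum fun t ht => ?_)
    · obtain rfl | ⟨K, rfl⟩ : j = 0 ∨ ∃ K, j = K + 1 := by cases j <;> simp
      · simp
      · refine le_trans (sum_le_sum fun t ht => ?_)
          ((sum_num312_terms_le _ (num123_antitone n K) K X hX).trans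
            (sum_le_sum fun t ht => ?_))
        · rw [mem_range] at ht
          rw [if_neg (by omega), Nat.add_sub_cancel]
          split_ifs
          · exact le_rfl
          · refine ih (by omega) fun h hh => ?_
            simp only [mem_union, mem_filter, mem_Ioo] at hh ⊢
            rcases hh with ⟨hh, h2⟩ | hh
            · have := mem_Ioo.1 (hX hh); omega
            · omega
        · rw [mem_range] at ht
          rw [if_neg (show ¬ K + 1 ≤ t by omega), Nat.add_sub_cancel]
    · rw [mem_Ico] at ht
      rw [if_pos ht.1, if_pos ht.1]
      exact ih (by omega) (hX.trans (Ioo_subset_Ioo_right ht.1))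

/-- The base case `n = 6` evaluates the two recurrences, to `512 < 513`. -/
lemma num312_lt_num123 {n : ℕ} (hn : 6 ≤ n) : num312 n 0 ∅ < num123 n 0 0 := by
  induction n, hn using Nat.le_induction with
  | base => decide +kernel
  | succ n _ ih =>
    rw [num312, num123]
    -- Strictness is inherited through the permutations that start with their maximum.
    refine sum_lt_sum (fun t ht => ?_) ⟨0, by simp, by simpa using ih⟩
    rw [mem_range] at ht
    simpa using num312_le_num123 (X := ∅) (Nat.lt_succ_iff.1 ht) (by simp)

/-! ### Avoidance of `1342` and `1234` -/

lemma contains_four_iff {n : ℕ} {p : Perm (Fin n)} {q : Perm (Fin 4)} :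
    Contains p q ↔ ∃ a b c d : Fin n, a < b ∧ b < c ∧ c < d ∧
      ∀ i k : Fin 4, p (![a, b, c, d] i) < p (![a, b, c, d] k) ↔ q i < q k := by
  constructor
  · rintro ⟨f, hf, h⟩
    refine ⟨f 0, f 1, f 2, f 3, hf (by decide), hf (by decide), hf (by decide), ?_⟩
    have : ![f 0, f 1, f 2, f 3] = f := by
      ext i
      fin_cases i <;> rfl
    rwa [this]
  · rintro ⟨a, b, c, d, hab, hbc, hcd, h⟩
    refine ⟨![a, b, c, d], ?_, h⟩
    rw [Fin.strictMono_iff_lt_succ]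
    intro i
    fin_cases i
    · exact hab
    · exact hbc
    · exact hcd

lemma avoids_1234_iff {n : ℕ} {p : Perm (Fin n)} :
    Avoids p pattern1234 ↔ AvoidsBelowLater Is123 p := by
  rw [Avoids, contains_four_iff]
  constructor
  · rintro h a b c d hab hbc hcd ⟨h1, h2⟩ ⟨-, -, h3⟩
    refine h ⟨a, b, c, d, hab, hbc, hcd, fun i k => ?_⟩
    fin_cases i <;> fin_cases k <;> simp [pattern1234] <;> omega
  · rintro h ⟨a, b, c, d, hab, hbc, hcd, H⟩
    have h1 : p a < p b := (H 0 1).2 (by decide)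
    have h2 : p b < p c := (H 1 2).2 (by decide)
    have h3 : p c < p d := (H 2 3).2 (by decide)
    exact h a b c d hab hbc hcd ⟨h1, h2⟩ ⟨h1.trans (h2.trans h3), h2.trans h3, h3⟩

/-- The reverse complement of a permutation. -/
def reverseComplement {n : ℕ} : Perm (Fin n) ≃ Perm (Fin n) :=
  Equiv.permCongr Fin.revPerm

lemma reverseComplement_apply {n : ℕ} (p : Perm (Fin n)) (i : Fin n) :
    reverseComplement p i = (p i.rev).rev := by
  simp [reverseComplement]

lemma avoids_1342_iff {n : ℕ} {p : Perm (Fin n)} :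
    Avoids p pattern1342 ↔ AvoidsBelowLater Is312 (reverseComplement p) := by
  rw [Avoids, contains_four_iff]
  constructor
  · rintro h a b c d hab hbc hcd ⟨h1, h2⟩ ⟨h3, -, -⟩
    simp only [reverseComplement_apply] at h1 h2 h3
    rw [← Fin.lt_def, Fin.rev_lt_rev] at h1 h2
    rw [Fin.rev_lt_rev] at h3
    refine h ⟨d.rev, c.rev, b.rev, a.rev, Fin.rev_lt_rev.2 hcd, Fin.rev_lt_rev.2 hbc,
      Fin.rev_lt_rev.2 hab, fun i k => ?_⟩
    fin_cases i <;> fin_cases k <;> simp [pattern1342] <;> omega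
  · rintro h ⟨a, b, c, d, hab, hbc, hcd, H⟩
    have h1 : p a < p d := (H 0 3).2 (by decide)
    have h2 : p d < p b := (H 3 1).2 (by decide)
    have h3 : p b < p c := (H 1 2).2 (by decide)
    refine h d.rev c.rev b.rev a.rev (Fin.rev_lt_rev.2 hcd) (Fin.rev_lt_rev.2 hbc)
      (Fin.rev_lt_rev.2 hab) ?_ ?_ <;>
    simp only [Is312, reverseComplement_apply, Fin.rev_rev, ← Fin.lt_def, Fin.rev_lt_rev]
    · exact ⟨h3, h2⟩
    · exact ⟨h1, h1.trans (h2.trans h3), h1.trans h2⟩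

lemma card_avoidsBelowLater (R : ℕ → ℕ → ℕ → Prop) (n : ℕ) :
    Nat.card {σ : Perm (Fin n) // AvoidsBelowLater R σ} = count R n 0 ∅ :=
  Nat.card_congr (Equiv.subtypeEquivRight fun σ => by
    simp [PrefixAvoids, DescendsInto])

/-- The reverse complement of `1342` is `3124`. -/
lemma S_1342 (n : ℕ) : S n pattern1342 = num312 n 0 ∅ := by
  rw [← count_312 (Nat.zero_le n) (by simp), ← card_avoidsBelowLater]
  exact Nat.card_congr (reverseComplement.subtypeEquiv fun p => avoids_1342_iff)

lemma S_1234 (n : ℕ) : S n pattern1234 = num123 n 0 0 := by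
  rw [← count_123 (Nat.zero_le n) le_rfl, show Ioo 0 (0 + 1) = (∅ : Finset ℕ) from rfl,
    ← card_avoidsBelowLater]
  exact Nat.card_congr (Equiv.subtypeEquivRight fun p => avoids_1234_iff)

end PatternAvoidance

theorem mainTheorem8 :
    ∀ n : ℕ, 6 ≤ n →
      PatternAvoidance.S n PatternAvoidance.pattern1342
        < PatternAvoidance.S n PatternAvoidance.pattern1234 := by
  intro n hn
  rw [PatternAvoidance.S_1342, PatternAvoidance.S_1234]
  exact PatternAvoidance.num312_lt_num123 hn
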